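/- Let $b, m, n$ be integers with $1 \le m \le b$ and $n \ge 1$. For an ordered $m$-subset $S = (s_1,\dots,s_m)$ of $[b]=\{1,\dots,b\}$ (that is, $s_1,\dots,s_m$ are distinct), the card $C_S$ has levels $1,\dots,b$, numbered from bottom to top, on its left and on its right side. It sends the ball on level $j$ on the left to level $s_j$ on the right for $1 \le j \le m$, and sends the remaining balls, with their order preserved, to the remaining $b-m$ levels. This defines a permutation $\pi_{C_S}$ of $[b]$. A sequence $A = C_{S_1} C_{S_2} \cdots C_{S_n}$ of such cards induces the permutation $\pi_A$ of $[b]$ obtained by applying $\pi_{C_{S_1}}$ first, then $\pi_{C_{S_2}}$, and so on; that is, a ball that starts on level $i$ on the left of the first card ends on level $\pi_A(i)$ on the right of the last card. Theorem. If $A$ is chosen uniformly at random among all sequences of length $n$ of cards $C_S$ with $|S| = m$ (that is, the $n$ cards are drawn independently and uniformly, with replacement), then the probability that $\pi_A$ is a $b$-cycle, i.e. consists of a single cycle through all $b$ elements (for $b=1$, the identity), equals $1/b$. In particular, this probability is independent of $n$. -/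

import Mathlib

namespace Juggling

/-- A card `C_S` for `b` balls at which `m` balls are thrown: it is given by an ordered subset
`S = (s_1, …, s_m)` of the set of levels. Levels are numbered `0, …, b - 1` from bottom to top,
and `throwTo j` is the level to which the ball on level `j` is thrown. -/
@[ext]
structure Card (b m : ℕ) where
  throwTo : Fin m ↪ Fin b

/-- Cards with the given parameters are the same thing as embeddings of `Fin m` in `Fin b`. -/
def cardEquiv (b m : ℕ) : Card b m ≃ (Fin m ↪ Fin b) where
  toFun C := C.throwTo
  invFun S := ⟨S⟩
  left_inv _ := rfl
  right_inv _ := rfl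

noncomputable instance (b m : ℕ) : Fintype (Card b m) := Fintype.ofEquiv _ (cardEquiv b m).symm

/-- The set of cards is finite and carries the discrete σ-algebra. -/
instance (b m : ℕ) : MeasurableSpace (Card b m) := ⊤

instance (b m : ℕ) : DiscreteMeasurableSpace (Card b m) := ⟨fun _ => trivial⟩

namespace Card

variable {b m : ℕ}

/-- The levels that are not the target of a thrown ball. -/
def free (C : Card b m) : Finset (Fin b) := (Finset.univ.map C.throwTo)ᶜ

theorem card_free (C : Card b m) : C.free.card = b - m := by
  simp [free, Finset.card_compl]

/-- The level on the right of the card reached by the ball on level `j` on the left: the ball on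
level `j < m` is thrown to `throwTo j`, and the remaining balls, from bottom to top, fill the
remaining levels from bottom to top. -/
def move (C : Card b m) (j : Fin b) : Fin b :=
  if h : (j : ℕ) < m then C.throwTo ⟨j, h⟩
  else C.free.orderEmbOfFin C.card_free ⟨j - m, by have := j.isLt; omega⟩

theorem move_injective (C : Card b m) : Function.Injective C.move := by
  have key : ∀ (i : Fin m) (k : Fin (b - m)),
      C.throwTo i ≠ C.free.orderEmbOfFin C.card_free k := by
    intro i k h
    have hk := Finset.orderEmbOfFin_mem C.free C.card_free k
    rw [← h] at hk
    simp [free] at hk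
  intro x y hxy
  unfold move at hxy
  split_ifs at hxy with hx hy hy
  · have := C.throwTo.injective hxy
    simpa [Fin.ext_iff] using this
  · exact (key _ _ hxy).elim
  · exact (key _ _ hxy.symm).elim
  · have := (C.free.orderEmbOfFin C.card_free).injective hxy
    simp only [Fin.mk.injEq] at this
    ext
    omega

/-- The permutation `π_C` of the levels induced by a card. -/
noncomputable def perm (C : Card b m) : Equiv.Perm (Fin b) :=
  Equiv.ofBijective C.move (Finite.injective_iff_bijective.mp C.move_injective)

end Card

/-- The permutation `π_A` induced by the juggling card sequence `A = A 0, A 1, …, A (n - 1)`: the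
balls traverse the cards from left to right, so that a ball starting on level `i` ends on level
`π_A i`, where `π_{A 0}` is applied first and `π_{A (n - 1)}` last. (In Mathlib the product `f * g`
of permutations applies `g` first, hence the reversal.) -/
noncomputable def seqPerm {b m n : ℕ} (A : Fin n → Card b m) : Equiv.Perm (Fin b) :=
  (List.ofFn fun i => (A i).perm).reverse.prod

/-- A permutation of the `b` levels is a `b`-cycle if it consists of a single cycle through all
levels. In particular, for `b = 1` the identity is a `1`-cycle. -/
def IsFullCycle {b : ℕ} (σ : Equiv.Perm (Fin b)) : Prop := σ.IsCycleOn Set.univ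

end Juggling

open Equiv Finset

namespace Juggling

/-! Cards with `k` throws are exactly the permutations increasing from level `k` on; let `cardSum b
k` be their sum in the group algebra. Multiplying by one-throw cards gives `cardSum b k * cardSum b
1 = k • cardSum b k + cardSum b (k + 1)` for `k < b`. So the span of the `cardSum b k` with `1 ≤ k ≤
b` is stable under multiplication by every `cardSum b m`, and contains `cardSum b m ^ n`, the sum
over all sequences (`cardSum_pow_mem`).

It remains to treat a single card: for each `k ≥ 1`, exactly one in `b` of the permutations in
`cardSum b k` is a full cycle (`mul_fullCycleCount`), by a recursion that cuts the lowest level out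
of its cycle. The proportion `1 / b` is a linear condition, so it extends to the span. The identity
`cardSum b 0` must stay out of the span, whence `n ≥ 1` and `m ≥ 1`. -/

/-- A permutation of the levels that is increasing on the levels `k, k + 1, …`. -/
def TailMono {b : ℕ} (k : ℕ) (σ : Perm (Fin b)) : Prop :=
  ∀ i j : Fin b, k ≤ (i : ℕ) → i < j → σ i < σ j

open Classical in
/-- The permutations that are increasing on the levels `k, k + 1, …`. -/
noncomputable def tailMonoPerms (b k : ℕ) : Finset (Perm (Fin b)) :=
  univ.filter (TailMono k)

theorem mem_tailMonoPerms {b k : ℕ} {σ : Perm (Fin b)} :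
    σ ∈ tailMonoPerms b k ↔ TailMono k σ := by
  simp [tailMonoPerms]

/-! ### Cards as permutations with increasing tail -/

namespace Card

variable {b k : ℕ}

theorem perm_of_lt (C : Card b k) {j : Fin b} (h : (j : ℕ) < k) :
    C.perm j = C.throwTo ⟨j, h⟩ := by
  simp [perm, move, h]

theorem perm_of_le (C : Card b k) {j : Fin b} (h : k ≤ (j : ℕ)) :
    C.perm j = C.free.orderEmbOfFin C.card_free ⟨j - k, by have := j.isLt; omega⟩ := by
  simp [perm, move, Nat.not_lt.mpr h]

theorem tailMono_perm (C : Card b k) : TailMono k C.perm := by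
  intro i j hi hij
  rw [perm_of_le C hi, perm_of_le C (hi.trans (Fin.le_def.mp hij.le)), OrderEmbedding.lt_iff_lt]
  simp only [Fin.lt_def] at hij ⊢
  omega

/-- The card that throws the balls on the levels below `k` as a given permutation does. -/
def ofPerm (hk : k ≤ b) (σ : Perm (Fin b)) : Card b k where
  throwTo := (Fin.castLEEmb hk).trans σ.toEmbedding

theorem ofPerm_throwTo (hk : k ≤ b) (σ : Perm (Fin b)) (i : Fin k) :
    (ofPerm hk σ).throwTo i = σ (Fin.castLE hk i) := rfl

/-- The tail of `σ` enumerates the free levels increasingly, and such an enumeration is unique. -/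
theorem perm_ofPerm (hk : k ≤ b) {σ : Perm (Fin b)} (hσ : TailMono k σ) :
    (ofPerm hk σ).perm = σ := by
  ext1 j
  rcases lt_or_ge (j : ℕ) k with h | h
  · rw [perm_of_lt _ h, ofPerm_throwTo]
    rfl
  · have key := Finset.orderEmbOfFin_unique (ofPerm hk σ).card_free
      (f := fun i : Fin (b - k) => σ ⟨k + i, by omega⟩) ?_ ?_
    · rw [perm_of_le _ h, ← key]
      exact congrArg σ (Fin.ext (Nat.add_sub_cancel' h))
    · intro x
      simp only [free, mem_compl, mem_map, mem_univ, true_and, not_exists, ofPerm_throwTo]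
      intro i hi
      have := congrArg Fin.val (σ.injective hi)
      simp at this
      omega
    · intro x y hxy
      exact hσ _ _ (Nat.le_add_right _ _) (Nat.add_lt_add_left (Fin.lt_def.mp hxy) k)

theorem ofPerm_perm (hk : k ≤ b) (C : Card b k) : ofPerm hk C.perm = C := by
  ext i
  rw [ofPerm_throwTo, perm_of_lt C (by simp)]
  rfl

theorem perm_injective (hk : k ≤ b) : Function.Injective (perm : Card b k → Perm (Fin b)) :=
  Function.LeftInverse.injective (ofPerm_perm hk)

theorem sum_perm {M : Type*} [AddCommMonoid M] (hk : k ≤ b) (f : Perm (Fin b) → M) :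
    ∑ C : Card b k, f C.perm = ∑ σ ∈ tailMonoPerms b k, f σ := by
  refine Finset.sum_bij (fun C _ => C.perm) ?_ ?_ ?_ ?_
  · exact fun C _ => mem_tailMonoPerms.mpr C.tailMono_perm
  · exact fun C _ D _ h => perm_injective hk h
  · exact fun σ hσ => ⟨ofPerm hk σ, mem_univ _, perm_ofPerm hk (mem_tailMonoPerms.mp hσ)⟩
  · exact fun _ _ => rfl

theorem card_eq : Fintype.card (Card b k) = b.descFactorial k := by
  rw [Fintype.card_congr (cardEquiv b k), Fintype.card_embedding_eq]
  simp

end Card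

theorem card_tailMonoPerms {b k : ℕ} (hk : k ≤ b) :
    (tailMonoPerms b k).card = b.descFactorial k := by
  rw [← Card.card_eq (b := b) (k := k), Finset.card_eq_sum_ones,
    ← Card.sum_perm hk (fun _ => 1)]
  simp

theorem tailMonoPerms_self_eq (b : ℕ) :
    tailMonoPerms (b + 1) (b + 1) = tailMonoPerms (b + 1) b := by
  symm
  refine Finset.eq_of_subset_of_card_le (fun σ _ => ?_) ?_
  · rw [mem_tailMonoPerms]
    intro i j hi
    omega
  · rw [card_tailMonoPerms le_rfl, card_tailMonoPerms (by omega), Nat.descFactorial_succ]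
    simp

/-- Permutations increasing from level `k` on are determined by their values below `k`. -/
theorem TailMono.eq_of_eq {b k : ℕ} (hk : k ≤ b) {σ τ : Perm (Fin b)} (hσ : TailMono k σ)
    (hτ : TailMono k τ) (h : ∀ j : Fin b, (j : ℕ) < k → σ j = τ j) : σ = τ := by
  rw [← Card.perm_ofPerm hk hσ, ← Card.perm_ofPerm hk hτ]
  congr 1
  ext i
  rw [Card.ofPerm_throwTo, Card.ofPerm_throwTo, h _ (by simp)]

/-! ### Multiplication by the cards that throw one ball -/

section Cycle

variable {b k : ℕ}

theorem TailMono.mul_cycleRange_symm {σ : Perm (Fin (b + 1))} (hσ : TailMono k σ)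
    {s : Fin (b + 1)} (hs : (s : ℕ) < k) : TailMono k (σ * s.cycleRange.symm) := by
  have fix : ∀ j : Fin (b + 1), k ≤ (j : ℕ) → s.cycleRange.symm j = j := fun j hj => by
    rw [Equiv.symm_apply_eq, Fin.cycleRange_of_gt (Fin.lt_def.mpr (by omega))]
  intro i j hi hij
  rw [Perm.mul_apply, Perm.mul_apply, fix i hi, fix j (hi.trans (Fin.le_def.mp hij.le))]
  exact hσ i j hi hij

theorem TailMono.mul_cycleRange {σ : Perm (Fin (b + 1))} (hσ : TailMono k σ)
    {s : Fin (b + 1)} (hs : (s : ℕ) < k) : TailMono k (σ * s.cycleRange) := by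
  have fix : ∀ j : Fin (b + 1), k ≤ (j : ℕ) → s.cycleRange j = j := fun j hj =>
    Fin.cycleRange_of_gt (Fin.lt_def.mpr (by omega))
  intro i j hi hij
  rw [Perm.mul_apply, Perm.mul_apply, fix i hi, fix j (hi.trans (Fin.le_def.mp hij.le))]
  exact hσ i j hi hij

/-- The inverse cycle sends `0` to `s` and `i + 1` to `s.succAbove i`, so it maps the levels from `k
+ 1` on increasingly into those from `k` on. -/
theorem TailMono.succ_mul_cycleRange_symm {σ : Perm (Fin (b + 1))} (hσ : TailMono k σ)
    (s : Fin (b + 1)) : TailMono (k + 1) (σ * s.cycleRange.symm) := by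
  intro i j hi hij
  have hj : k + 1 ≤ (j : ℕ) := hi.trans (Fin.le_def.mp hij.le)
  obtain ⟨i, rfl⟩ := Fin.exists_succ_eq.mpr (show i ≠ 0 by rintro rfl; simp at hi)
  obtain ⟨j, rfl⟩ := Fin.exists_succ_eq.mpr (show j ≠ 0 by rintro rfl; simp at hj)
  rw [Perm.mul_apply, Perm.mul_apply, Fin.cycleRange_symm_succ, Fin.cycleRange_symm_succ]
  refine hσ _ _ ?_ (Fin.strictMono_succAbove s (Fin.succ_lt_succ_iff.mp hij))
  simp only [Fin.val_succ] at hi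
  rcases lt_or_ge i.castSucc s with h | h
  · rw [Fin.succAbove_of_castSucc_lt _ _ h]
    simp
    omega
  · rw [Fin.succAbove_of_le_castSucc _ _ h]
    simp
    omega

theorem sum_mul_cycleRange_symm_of_lt {M : Type*} [AddCommMonoid M] (f : Perm (Fin (b + 1)) → M)
    {s : Fin (b + 1)} (hs : (s : ℕ) < k) :
    ∑ σ ∈ tailMonoPerms (b + 1) k, f (σ * s.cycleRange.symm) =
      ∑ σ ∈ tailMonoPerms (b + 1) k, f σ := by
  refine Finset.sum_bij' (fun σ _ => σ * s.cycleRange.symm) (fun σ _ => σ * s.cycleRange)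
    ?_ ?_ ?_ ?_ ?_
  · exact fun σ hσ => mem_tailMonoPerms.mpr ((mem_tailMonoPerms.mp hσ).mul_cycleRange_symm hs)
  · exact fun σ hσ => mem_tailMonoPerms.mpr ((mem_tailMonoPerms.mp hσ).mul_cycleRange hs)
  · intro σ _
    ext1 x
    simp
  · intro σ _
    ext1 x
    simp
  · exact fun _ _ => rfl

theorem card_filter_le_val (hk : k ≤ b) :
    (univ.filter fun s : Fin b => k ≤ (s : ℕ)).card = b - k := by
  have h := Finset.card_filter_add_card_filter_not (s := (univ : Finset (Fin b)))
    (fun s : Fin b => (s : ℕ) < k)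
  simp only [not_lt, card_univ, Fintype.card_fin, Fin.card_filter_val_lt] at h
  omega

/-- The products are pairwise distinct and lie in the target set; counting both sides shows that
they exhaust it. -/
theorem sum_mul_cycleRange_symm_of_le {M : Type*} [AddCommMonoid M] (f : Perm (Fin (b + 1)) → M)
    (hk : k ≤ b) :
    ∑ s ∈ univ.filter (fun s : Fin (b + 1) => k ≤ (s : ℕ)),
        ∑ σ ∈ tailMonoPerms (b + 1) k, f (σ * s.cycleRange.symm) =
      ∑ σ ∈ tailMonoPerms (b + 1) (k + 1), f σ := by
  classical
  rw [← Finset.sum_product']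
  set P := (univ.filter fun s : Fin (b + 1) => k ≤ (s : ℕ)) ×ˢ tailMonoPerms (b + 1) k with hP
  have hmem : ∀ p ∈ P, k ≤ (p.1 : ℕ) ∧ TailMono k p.2 := by
    intro p hp
    simpa [hP, mem_tailMonoPerms] using hp
  have hinj : Set.InjOn (fun p : Fin (b + 1) × Perm (Fin (b + 1)) => p.2 * p.1.cycleRange.symm)
      P := by
    rintro ⟨s, σ⟩ hp ⟨t, τ⟩ hq h
    obtain ⟨hs, hσ⟩ := hmem _ hp
    obtain ⟨ht, hτ⟩ := hmem _ hq
    simp only at hs ht hσ hτ h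
    have hστ : σ = τ := by
      refine hσ.eq_of_eq (by omega) hτ fun j hj => ?_
      obtain ⟨i, hi⟩ : ∃ i : Fin b, i.castSucc = j :=
        ⟨⟨j, by omega⟩, by ext; simp⟩
      -- Since `i < k ≤ s, t`, both inverse cycles send `i + 1` to `i`, so the product at `i + 1`
      -- recovers `σ` below `k`. Its value at `0` is `σ s`, which later recovers `s`.
      have h' := DFunLike.congr_fun h i.succ
      have hval : (i : ℕ) = j := by rw [← hi]; simp
      rwa [Perm.mul_apply, Perm.mul_apply, Fin.cycleRange_symm_succ, Fin.cycleRange_symm_succ,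
        Fin.succAbove_of_castSucc_lt _ _ (Fin.lt_def.mpr (by simp; omega)),
        Fin.succAbove_of_castSucc_lt _ _ (Fin.lt_def.mpr (by simp; omega)), hi] at h'
    subst hστ
    have h0 := DFunLike.congr_fun h 0
    rw [Perm.mul_apply, Perm.mul_apply, Fin.cycleRange_symm_zero, Fin.cycleRange_symm_zero] at h0
    rw [σ.injective h0]
  have himage : P.image (fun p => p.2 * p.1.cycleRange.symm) = tailMonoPerms (b + 1) (k + 1) := by
    refine Finset.eq_of_subset_of_card_le ?_ ?_
    · intro σ hσ
      obtain ⟨p, hp, rfl⟩ := mem_image.mp hσ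
      exact mem_tailMonoPerms.mpr ((hmem p hp).2.succ_mul_cycleRange_symm p.1)
    · rw [card_image_of_injOn hinj, hP, card_product, card_filter_le_val (by omega),
        card_tailMonoPerms (by omega), card_tailMonoPerms (by omega), Nat.descFactorial_succ]
  rw [← himage, Finset.sum_image hinj]

end Cycle

/-! ### The group algebra -/

section Algebra

/-- The sum of the permutations increasing from level `k` on; for `k ≤ b` this is the sum of the
permutations of the cards with `k` throws. -/
noncomputable def cardSum (b k : ℕ) : MonoidAlgebra ℚ (Perm (Fin b)) :=
  ∑ σ ∈ tailMonoPerms b k, MonoidAlgebra.single σ 1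

theorem cardSum_zero (b : ℕ) : cardSum b 0 = 1 := by
  have : tailMonoPerms b 0 = {1} := by
    ext σ
    rw [mem_tailMonoPerms, mem_singleton]
    constructor
    · intro h
      refine h.eq_of_eq b.zero_le ?_ (by simp)
      exact fun i j _ hij => hij
    · rintro rfl
      exact fun i j _ hij => hij
  rw [cardSum, this, sum_singleton, MonoidAlgebra.one_def]

/-- Each of the `k` targets `s < k` only permutes the levels below `k` and reproduces `cardSum`; the
targets `s ≥ k` together give the next one. -/
theorem cardSum_mul_sum_cycleRange_symm {b k : ℕ} (hk : k ≤ b) :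
    cardSum (b + 1) k * ∑ s : Fin (b + 1), MonoidAlgebra.single s.cycleRange.symm 1 =
      (k : ℚ) • cardSum (b + 1) k + cardSum (b + 1) (k + 1) := by
  have h : ∀ s : Fin (b + 1), cardSum (b + 1) k * MonoidAlgebra.single s.cycleRange.symm 1 =
      ∑ σ ∈ tailMonoPerms (b + 1) k, MonoidAlgebra.single (σ * s.cycleRange.symm) (1 : ℚ) := by
    intro s
    simp [cardSum, Finset.sum_mul, MonoidAlgebra.single_mul_single]
  rw [Finset.mul_sum, Finset.sum_congr rfl fun s _ => h s,
    ← Finset.sum_filter_add_sum_filter_not univ (fun s : Fin (b + 1) => (s : ℕ) < k)]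
  congr 1
  · rw [Finset.sum_congr rfl fun s hs => sum_mul_cycleRange_symm_of_lt
      (fun σ => MonoidAlgebra.single σ (1 : ℚ)) (mem_filter.mp hs).2, Finset.sum_const,
      Fin.card_filter_val_lt, min_eq_right (by omega), ← Nat.cast_smul_eq_nsmul ℚ]
    rfl
  · simp only [not_lt]
    exact sum_mul_cycleRange_symm_of_le (fun σ => MonoidAlgebra.single σ (1 : ℚ)) hk

theorem sum_cycleRange_symm_eq (b : ℕ) :
    ∑ s : Fin (b + 1), MonoidAlgebra.single s.cycleRange.symm 1 = cardSum (b + 1) 1 := by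
  simpa [cardSum_zero] using cardSum_mul_sum_cycleRange_symm b.zero_le

theorem cardSum_mul_cardSum_one {b k : ℕ} (hk : k < b) :
    cardSum b k * cardSum b 1 = (k : ℚ) • cardSum b k + cardSum b (k + 1) := by
  obtain ⟨b, rfl⟩ : ∃ c, b = c + 1 := ⟨b - 1, by omega⟩
  rw [← sum_cycleRange_symm_eq, cardSum_mul_sum_cycleRange_symm (by omega)]

theorem cardSum_self_eq (b : ℕ) : cardSum (b + 1) (b + 1) = cardSum (b + 1) b := by
  rw [cardSum, tailMonoPerms_self_eq, cardSum]

/-- The span of the elements `cardSum b k` with `1 ≤ k ≤ b`. -/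
noncomputable def cardSpan (b : ℕ) : Submodule ℚ (MonoidAlgebra ℚ (Perm (Fin b))) :=
  Submodule.span ℚ (cardSum b '' Set.Icc 1 b)

theorem cardSum_mem_cardSpan {b k : ℕ} (h1 : 1 ≤ k) (hk : k ≤ b) : cardSum b k ∈ cardSpan b :=
  Submodule.subset_span ⟨k, ⟨h1, hk⟩, rfl⟩

theorem mul_cardSum_one_mem {b : ℕ} {x : MonoidAlgebra ℚ (Perm (Fin b))} (hx : x ∈ cardSpan b) :
    x * cardSum b 1 ∈ cardSpan b := by
  induction hx using Submodule.span_induction with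
  | mem x hx =>
    obtain ⟨k, ⟨h1, hk⟩, rfl⟩ := hx
    rcases hk.lt_or_eq with h | rfl
    · rw [cardSum_mul_cardSum_one h]
      exact add_mem (Submodule.smul_mem _ _ (cardSum_mem_cardSpan h1 hk))
        (cardSum_mem_cardSpan (by omega) h)
    · obtain ⟨c, rfl⟩ : ∃ c, k = c + 1 := ⟨k - 1, by omega⟩
      -- At the top index the product rule is applied to `c` instead, as `cardSum` agrees at `c` and
      -- `c + 1`.
      have h := cardSum_mul_cardSum_one c.lt_succ_self
      rw [Nat.succ_eq_add_one, ← cardSum_self_eq] at h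
      rw [h]
      exact add_mem (Submodule.smul_mem _ _ (cardSum_mem_cardSpan h1 hk))
        (cardSum_mem_cardSpan h1 hk)
  | zero => simp
  | add x y _ _ hx hy =>
    rw [add_mul]
    exact add_mem hx hy
  | smul a x _ hx =>
    rw [smul_mul_assoc]
    exact Submodule.smul_mem _ _ hx

theorem mul_cardSum_mem {b m : ℕ} (hm : m ≤ b) {x : MonoidAlgebra ℚ (Perm (Fin b))}
    (hx : x ∈ cardSpan b) : x * cardSum b m ∈ cardSpan b := by
  induction m with
  | zero => simpa [cardSum_zero] using hx
  | succ m ih =>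
    have h : x * cardSum b (m + 1) =
        x * cardSum b m * cardSum b 1 - (m : ℚ) • (x * cardSum b m) := by
      rw [mul_assoc, cardSum_mul_cardSum_one hm, mul_add, mul_smul_comm]
      abel
    rw [h]
    exact sub_mem (mul_cardSum_one_mem (ih (by omega)))
      (Submodule.smul_mem _ _ (ih (by omega)))

theorem cardSum_pow_mem {b m n : ℕ} (h1 : 1 ≤ m) (hm : m ≤ b) (hn : 1 ≤ n) :
    cardSum b m ^ n ∈ cardSpan b := by
  induction n, hn using Nat.le_induction with
  | base => simpa using cardSum_mem_cardSpan h1 hm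
  | succ n _ ih =>
    rw [pow_succ]
    exact mul_cardSum_mem hm ih

theorem seqPerm_cons {b m n : ℕ} (C : Card b m) (A : Fin n → Card b m) :
    seqPerm (Fin.cons C A : Fin (n + 1) → Card b m) = seqPerm A * C.perm := by
  simp [seqPerm, List.ofFn_succ]

theorem sum_single_seqPerm {b m : ℕ} (hm : m ≤ b) (n : ℕ) :
    ∑ A : Fin n → Card b m, MonoidAlgebra.single (seqPerm A) (1 : ℚ) = cardSum b m ^ n := by
  induction n with
  | zero => simp [seqPerm, MonoidAlgebra.one_def]
  | succ n ih =>
    rw [← (Fin.consEquiv fun _ => Card b m).sum_comp, Fintype.sum_prod_type, pow_succ, ← ih,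
      cardSum, ← Card.sum_perm hm, Finset.mul_sum]
    refine Finset.sum_congr rfl fun C _ => ?_
    rw [Finset.sum_mul]
    refine Finset.sum_congr rfl fun A _ => ?_
    rw [MonoidAlgebra.single_mul_single, mul_one, ← seqPerm_cons]
    rfl

end Algebra

/-! ### Full cycles -/

section FullCycle

variable {b k : ℕ}

theorem isFullCycle_iff {σ : Perm (Fin b)} : IsFullCycle σ ↔ ∀ x y, σ.SameCycle x y := by
  constructor
  · exact fun h x y => h.2 (Set.mem_univ x) (Set.mem_univ y)
  · exact fun h => ⟨by simp, fun x _ y _ => h x y⟩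

/-- Insert a new lowest level into a permutation, in the cycle of `i` and immediately after `i`. -/
def insertZero (i : Fin b) (e : Perm (Fin b)) : Perm (Fin (b + 1)) :=
  Perm.decomposeFin.symm ((e i).succ, e)

theorem insertZero_zero (i : Fin b) (e : Perm (Fin b)) : insertZero i e 0 = (e i).succ := by
  simp [insertZero]

theorem insertZero_succ_self (i : Fin b) (e : Perm (Fin b)) : insertZero i e i.succ = 0 := by
  simp [insertZero]

theorem insertZero_succ_of_ne {i j : Fin b} (h : j ≠ i) (e : Perm (Fin b)) :
    insertZero i e j.succ = (e j).succ := by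
  rw [insertZero, Perm.decomposeFin_symm_apply_succ, swap_apply_of_ne_of_ne (Fin.succ_ne_zero _)]
  simpa using h

theorem sameCycle_insertZero_succ (i : Fin b) (e : Perm (Fin b)) (x : Fin b) :
    (insertZero i e).SameCycle x.succ (e x).succ := by
  by_cases h : x = i
  · subst h
    exact ⟨2, by rw [zpow_two, Perm.mul_apply, insertZero_succ_self, insertZero_zero]⟩
  · exact ⟨1, by rw [zpow_one, insertZero_succ_of_ne h]⟩

theorem isFullCycle_insertZero (i : Fin b) (e : Perm (Fin b)) :
    IsFullCycle (insertZero i e) ↔ IsFullCycle e := by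
  rw [isFullCycle_iff, isFullCycle_iff]
  constructor
  · intro h x y
    -- Follow the orbit of `x.succ`, counting a visit to the new level `0` as still being at `i`.
    have key : ∀ n : ℕ, (∀ z : Fin b, z.succ = ((insertZero i e) ^ n) x.succ → e.SameCycle x z) ∧
        (0 = ((insertZero i e) ^ n) x.succ → e.SameCycle x i) := by
      intro n
      induction n with
      | zero =>
        refine ⟨fun z hz => ?_, fun h0 => ?_⟩
        · rw [pow_zero, Perm.one_apply] at hz
          rw [Fin.succ_injective _ hz]
        · rw [pow_zero, Perm.one_apply] at h0
          exact absurd h0.symm (Fin.succ_ne_zero _)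
      | succ n ih =>
        rw [pow_succ', Perm.mul_apply]
        rcases Fin.eq_zero_or_eq_succ (((insertZero i e) ^ n) x.succ) with h0 | ⟨w, hw⟩
        · rw [h0, insertZero_zero]
          refine ⟨fun z hz => ?_, fun h => absurd h.symm (Fin.succ_ne_zero _)⟩
          rw [Fin.succ_injective _ hz, Perm.sameCycle_apply_right]
          exact ih.2 h0.symm
        · have hxw := ih.1 w hw.symm
          rw [hw]
          by_cases hwi : w = i
          · subst hwi
            rw [insertZero_succ_self]
            exact ⟨fun z hz => absurd hz (Fin.succ_ne_zero _), fun _ => hxw⟩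
          · rw [insertZero_succ_of_ne hwi]
            refine ⟨fun z hz => ?_, fun h => absurd h.symm (Fin.succ_ne_zero _)⟩
            rwa [Fin.succ_injective _ hz, Perm.sameCycle_apply_right]
    obtain ⟨n, hn⟩ := (h x.succ y.succ).exists_nat_pow_eq
    exact (key n).1 y hn.symm
  · intro h
    have hsucc : ∀ x y : Fin b, (insertZero i e).SameCycle x.succ y.succ := by
      intro x y
      obtain ⟨n, rfl⟩ := (h x y).exists_nat_pow_eq
      induction n with
      | zero => exact Perm.SameCycle.refl _ _
      | succ n ih =>
        rw [pow_succ', Perm.mul_apply]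
        exact ih.trans (sameCycle_insertZero_succ i e _)
    have hi : ∀ x, (insertZero i e).SameCycle i.succ x := by
      intro x
      rcases Fin.eq_zero_or_eq_succ x with rfl | ⟨x, rfl⟩
      · exact ⟨1, by rw [zpow_one, insertZero_succ_self]⟩
      · exact hsucc i x
    exact fun x y => (hi x).symm.trans (hi y)

/-- The least value `0` sits at `i + 1`, so an increasing tail has it before the tail (`i < k`) or
at its first place (`i = k`); in the latter case only the rest constrains `e`. -/
theorem tailMono_insertZero (i : Fin b) (e : Perm (Fin b)) :
    TailMono (k + 1) (insertZero i e) ↔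
      ((i : ℕ) < k ∧ TailMono k e) ∨ ((i : ℕ) = k ∧ TailMono (k + 1) e) := by
  constructor
  · intro h
    have hik : (i : ℕ) ≤ k := by
      by_contra! hlt
      have := h (⟨k, by omega⟩ : Fin b).succ i.succ (by simp) (by simpa [Fin.lt_def] using hlt)
      rw [insertZero_succ_self] at this
      simp at this
    have step : ∀ x y : Fin b, k ≤ (x : ℕ) → x ≠ i → x < y → e x < e y := by
      intro x y hx hxi hxy
      have hyi : y ≠ i := by
        rintro rfl
        simp only [Fin.lt_def] at hxy
        omega
      have := h x.succ y.succ (by simpa using hx) (Fin.succ_lt_succ_iff.mpr hxy)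
      rwa [insertZero_succ_of_ne hxi, insertZero_succ_of_ne hyi, Fin.succ_lt_succ_iff] at this
    rcases hik.lt_or_eq with hlt | heq
    · exact Or.inl ⟨hlt, fun x y hx hxy => step x y hx (by rintro rfl; omega) hxy⟩
    · exact Or.inr ⟨heq, fun x y hx hxy => step x y (by omega) (by rintro rfl; omega) hxy⟩
  · intro h x y hx hxy
    have hy : k + 1 ≤ (y : ℕ) := hx.trans (Fin.le_def.mp hxy.le)
    obtain ⟨x, rfl⟩ := Fin.exists_succ_eq.mpr (show x ≠ 0 by rintro rfl; simp at hx)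
    obtain ⟨y, rfl⟩ := Fin.exists_succ_eq.mpr (show y ≠ 0 by rintro rfl; simp at hy)
    rw [Fin.succ_lt_succ_iff] at hxy
    simp only [Fin.val_succ, Nat.add_le_add_iff_right] at hx hy
    have hyi : y ≠ i := by
      rintro rfl
      simp only [Fin.lt_def] at hxy
      omega
    rw [insertZero_succ_of_ne hyi]
    by_cases hxi : x = i
    · subst hxi
      rw [insertZero_succ_self]
      exact Fin.succ_pos _
    · rw [insertZero_succ_of_ne hxi, Fin.succ_lt_succ_iff]
      rcases h with ⟨_, h⟩ | ⟨hik, h⟩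
      · exact h x y hx hxy
      · refine h x y ?_ hxy
        have : (x : ℕ) ≠ i := fun h => hxi (Fin.ext h)
        omega

theorem not_isFullCycle_decomposeFin_symm_zero (hb : 1 ≤ b) (e : Perm (Fin b)) :
    ¬ IsFullCycle (Perm.decomposeFin.symm ((0 : Fin (b + 1)), e)) := by
  rw [isFullCycle_iff]
  intro h
  have := (h 0 (⟨0, hb⟩ : Fin b).succ).eq_of_left (by simp [Function.IsFixedPt])
  exact Fin.succ_ne_zero _ this.symm

open Classical in
/-- The number of `b`-cycles that are increasing on the levels `k, k + 1, …`. -/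
noncomputable def fullCycleCount (b k : ℕ) : ℕ :=
  ∑ σ ∈ tailMonoPerms b k, if IsFullCycle σ then 1 else 0

theorem fullCycleCount_succ (hk : k < b) :
    fullCycleCount (b + 1) (k + 1) = k * fullCycleCount b k + fullCycleCount b (k + 1) := by
  classical
  have expand : ∀ c l, fullCycleCount c l =
      ∑ σ : Perm (Fin c), if TailMono l σ ∧ IsFullCycle σ then 1 else 0 := by
    intro c l
    rw [fullCycleCount, tailMonoPerms, Finset.sum_filter]
    exact Finset.sum_congr rfl fun σ _ => by rw [ite_and]
  rw [expand, expand, expand, ← Perm.decomposeFin.symm.sum_comp, Fintype.sum_prod_type,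
    Finset.sum_comm, Finset.mul_sum, ← Finset.sum_add_distrib]
  refine Finset.sum_congr rfl fun e _ => ?_
  -- Permutations fixing `0` drop out; the others are reindexed by the predecessor `i` of `0`, with
  -- `k` choices `i < k` and one `i = k`.
  rw [Fin.sum_univ_succ, if_neg fun h => not_isFullCycle_decomposeFin_symm_zero (by omega) e h.2,
    zero_add, ← Equiv.sum_comp e]
  have h : ∀ i : Fin b, (if TailMono (k + 1) (Perm.decomposeFin.symm ((e i).succ, e)) ∧
        IsFullCycle (Perm.decomposeFin.symm ((e i).succ, e)) then 1 else 0) =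
      (if (i : ℕ) < k then (if TailMono k e ∧ IsFullCycle e then 1 else 0) else 0) +
      (if i = ⟨k, hk⟩ then (if TailMono (k + 1) e ∧ IsFullCycle e then 1 else 0) else 0) := by
    intro i
    have h1 := isFullCycle_insertZero i e
    have h2 := tailMono_insertZero (k := k) i e
    rw [insertZero] at h1 h2
    simp only [h1, h2, Fin.ext_iff]
    rcases lt_trichotomy (i : ℕ) k with h | h | h
    · simp [h, h.ne]
    · simp [h]
    · simp [h.not_gt, h.ne']
  rw [Finset.sum_congr rfl fun i _ => h i, Finset.sum_add_distrib, ← Finset.sum_filter,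
    Finset.sum_const, Fin.card_filter_val_lt, min_eq_right hk.le, smul_eq_mul,
    Finset.sum_ite_eq' univ, if_pos (mem_univ _)]

theorem fullCycleCount_eq (hk : k ≤ b) : fullCycleCount (b + 1) (k + 1) = b.descFactorial k := by
  induction b generalizing k with
  | zero =>
    obtain rfl : k = 0 := by omega
    have h : ∀ σ : Perm (Fin 1), IsFullCycle σ := fun σ => isFullCycle_iff.mpr fun x y => by
      rw [Subsingleton.elim x y]
    simp [fullCycleCount, h, card_tailMonoPerms]
  | succ b ih =>
    have main : ∀ l, l ≤ b → fullCycleCount (b + 2) (l + 1) = (b + 1).descFactorial l := by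
      intro l hl
      rw [fullCycleCount_succ (by omega), ih hl]
      cases l with
      | zero => simp
      | succ l =>
        rw [ih (by omega), Nat.succ_descFactorial_succ, Nat.descFactorial_succ, ← add_mul]
        congr 1
        omega
    rcases hk.lt_or_eq with h | rfl
    · exact main k (by omega)
    -- The recursion stops short of the top index, where the tail has one level and the condition is
    -- vacuous, as it is one index higher.
    · rw [fullCycleCount, tailMonoPerms_self_eq, ← fullCycleCount, main b le_rfl,
        Nat.descFactorial_succ]
      simp

theorem mul_fullCycleCount (h1 : 1 ≤ k) (hk : k ≤ b) :
    b * fullCycleCount b k = b.descFactorial k := by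
  obtain ⟨b, rfl⟩ : ∃ c, b = c + 1 := ⟨b - 1, by omega⟩
  obtain ⟨k, rfl⟩ : ∃ c, k = c + 1 := ⟨k - 1, by omega⟩
  rw [fullCycleCount_eq (by omega), Nat.succ_descFactorial_succ]

end FullCycle

/-! ### The probability -/

open Classical in
/-- The linear functional that compares the weight of the full cycles with the total weight. -/
noncomputable def cycleExcess (b : ℕ) : MonoidAlgebra ℚ (Perm (Fin b)) →ₗ[ℚ] ℚ :=
  (Finsupp.linearCombination ℚ fun σ : Perm (Fin b) =>
    (b : ℚ) * (if IsFullCycle σ then 1 else 0) - 1) ∘ₗ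
      (MonoidAlgebra.coeffLinearEquiv ℚ).toLinearMap

open Classical in
theorem cycleExcess_single {b : ℕ} (σ : Perm (Fin b)) :
    cycleExcess b (MonoidAlgebra.single σ 1) = (b : ℚ) * (if IsFullCycle σ then 1 else 0) - 1 := by
  simp [cycleExcess]

theorem cycleExcess_cardSum {b k : ℕ} (h1 : 1 ≤ k) (hk : k ≤ b) :
    cycleExcess b (cardSum b k) = 0 := by
  classical
  have h := mul_fullCycleCount h1 hk
  rw [← card_tailMonoPerms hk, fullCycleCount] at h
  have h' : (b : ℚ) * ∑ σ ∈ tailMonoPerms b k, (if IsFullCycle σ then 1 else 0) =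
      (tailMonoPerms b k).card := by
    rw [← h]
    push_cast
    rfl
  simp only [cardSum, map_sum, cycleExcess_single]
  rw [Finset.sum_sub_distrib, ← Finset.mul_sum, h']
  simp

theorem cycleExcess_eq_zero {b : ℕ} {x : MonoidAlgebra ℚ (Perm (Fin b))} (hx : x ∈ cardSpan b) :
    cycleExcess b x = 0 := by
  have : cardSpan b ≤ LinearMap.ker (cycleExcess b) := by
    refine Submodule.span_le.mpr ?_
    rintro _ ⟨k, ⟨h1, hk⟩, rfl⟩
    exact cycleExcess_cardSum h1 hk
  exact this hx

open Classical in
theorem mul_card_filter_isFullCycle {b m n : ℕ} (hm : 1 ≤ m) (hmb : m ≤ b) (hn : 1 ≤ n) :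
    b * (univ.filter fun A : Fin n → Card b m => IsFullCycle (seqPerm A)).card =
      Fintype.card (Fin n → Card b m) := by
  have h := cycleExcess_eq_zero (cardSum_pow_mem hm hmb hn)
  rw [← sum_single_seqPerm hmb n, map_sum] at h
  simp only [cycleExcess_single] at h
  rw [Finset.sum_sub_distrib, ← Finset.mul_sum, sub_eq_zero, Finset.sum_boole] at h
  rw [← Finset.card_univ, Finset.card_eq_sum_ones univ]
  exact_mod_cast h

end Juggling

/-- If `1 ≤ m ≤ b` and `n ≥ 1`, and a length-`n` sequence `A` of cards for `b` balls, each throwing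
`m` balls, is chosen uniformly at random, then `π_A` is a `b`-cycle with probability `1 / b`. -/
theorem mainTheorem8 (b m n : ℕ) (hm : 1 ≤ m) (hmb : m ≤ b) (hn : 1 ≤ n) :
    ProbabilityTheory.uniformOn (Set.univ : Set (Fin n → Juggling.Card b m))
        {A | Juggling.IsFullCycle (Juggling.seqPerm A)} = 1 / (b : ENNReal) := by
  classical
  have h := Juggling.mul_card_filter_isFullCycle hm hmb hn
  have hpos : 0 < Fintype.card (Fin n → Juggling.Card b m) := by
    rw [Fintype.card_fun, Juggling.Card.card_eq]
    exact pow_pos (Nat.descFactorial_pos.mpr hmb) _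
  have hset : {A : Fin n → Juggling.Card b m | Juggling.IsFullCycle (Juggling.seqPerm A)} =
      ((univ.filter fun A : Fin n → Juggling.Card b m =>
        Juggling.IsFullCycle (Juggling.seqPerm A) : Finset _) : Set _) := by
    simp
  rw [ProbabilityTheory.uniformOn_univ, hset, MeasureTheory.Measure.count_apply_finset, ← h]
  rw [← h] at hpos
  have hc := Nat.pos_of_mul_pos_left hpos
  rw [Nat.cast_mul, ENNReal.div_eq_div_iff (by simp; omega) (by simp)
    (by exact_mod_cast hpos.ne') (by finiteness), mul_one, mul_comm]
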